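/- Let $(\mathbb X,d)$ be a metric space with a distinguished point $0\in\mathbb X$ such that: - $\mathbb X$ is self-similar: there are $\lambda>1$ and a bijection $f:\mathbb X\to\mathbb X$ with $d(f(x),f(y))=\lambda\, d(x,y)$ for all $x,y\in\mathbb X$; - $\mathbb X$ is doubling: there is $D\in\mathbb N$ such that, for every $r>0$, every closed ball of radius $r$ in $\mathbb X$ can be covered by at most $D$ closed balls of radius $r/2$; - $\mathbb X$ is homogeneous: for all $x,y\in\mathbb X$ there is an isometry of $\mathbb X$ onto itself sending $x$ to $y$. Let $X\subseteq\mathbb X$ be a net, that is, for some $\varepsilon,\delta>0$ we have $d(x,y)\ge\varepsilon$ for all distinct $x,y\in X$, and for every $x\in\mathbb X$ there is $y\in X$ with $d(x,y)<\delta$. Equip $X$ with the restriction of $d$ and with an arbitrary distinguished point $p\in X$ (for instance $p=0$ if $0\in X$). For a metric space $M$ with a distinguished point, let $\operatorname{Lip}_0(M)$ denote the space of all Lipschitz functions $f:M\to\mathbb R$ vanishing at the distinguished point, with the norm $\|f\|_{\operatorname{Lip}}=\sup_{x\ne y}\frac{|f(x)-f(y)|}{d(x,y)}$ (where $\sup\emptyset=0$).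 Then $\operatorname{Lip}_0(\mathbb X)\simeq\operatorname{Lip}_0(X)$, that is, there is a bounded linear bijection $\operatorname{Lip}_0(\mathbb X)\to\operatorname{Lip}_0(X)$ with bounded inverse. -/

import Mathlib

/-- The vector space of real-valued Lipschitz functions on `M` vanishing at the point `o`. -/
def lip0Submodule (M : Type*) [MetricSpace M] (o : M) : Submodule ℝ (M → ℝ) where
  carrier := {f | f o = 0 ∧ ∃ K : NNReal, LipschitzWith K f}
  zero_mem' := ⟨rfl, 0, LipschitzWith.const 0⟩
  add_mem' := by
    rintro f g ⟨hf, K, hK⟩ ⟨hg, L, hL⟩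
    exact ⟨by simp [hf, hg], K + L, hK.add hL⟩
  smul_mem' := by
    rintro c f ⟨hf, K, hK⟩
    refine ⟨by simp [hf], ‖c‖₊ * K, LipschitzWith.of_dist_le_mul fun x y => ?_⟩
    have h := hK.dist_le_mul x y
    rw [Real.dist_eq] at h ⊢
    simp only [Pi.smul_apply, smul_eq_mul, ← mul_sub, abs_mul, NNReal.coe_mul, coe_nnnorm,
      Real.norm_eq_abs, mul_assoc]
    exact mul_le_mul_of_nonneg_left h (abs_nonneg c)

/-- `Lip₀(M)`: the real-valued Lipschitz functions on `M` vanishing at the distinguished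
point `o`, to be equipped with the Lipschitz norm. It is a type synonym, so that it does not
carry the topology of pointwise convergence. -/
def Lip0 (M : Type*) [MetricSpace M] (o : M) : Type _ := lip0Submodule M o

namespace Lip0

variable {M : Type*} [MetricSpace M] {o : M}

instance : AddCommGroup (Lip0 M o) := inferInstanceAs (AddCommGroup (lip0Submodule M o))

instance : Module ℝ (Lip0 M o) := inferInstanceAs (Module ℝ (lip0Submodule M o))

instance : CoeFun (Lip0 M o) fun _ => M → ℝ := ⟨fun f => f.1⟩

/-- The Lipschitz norm `sup_{x ≠ y} |f x - f y| / d(x, y)`. Pairs with `x = y` contribute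
`0 / 0 = 0` and do not affect the supremum. -/
noncomputable instance : Norm (Lip0 M o) :=
  ⟨fun f => ⨆ p : M × M, |f p.1 - f p.2| / dist p.1 p.2⟩

theorem norm_def (f : Lip0 M o) : ‖f‖ = ⨆ p : M × M, |f p.1 - f p.2| / dist p.1 p.2 := rfl

@[ext] theorem ext {f g : Lip0 M o} (h : ∀ x, f x = g x) : f = g := Subtype.ext (funext h)

theorem map_base (f : Lip0 M o) : f o = 0 := f.2.1

theorem add_apply (f g : Lip0 M o) (x : M) : (f + g) x = f x + g x := rfl

theorem smul_apply (c : ℝ) (f : Lip0 M o) (x : M) : (c • f) x = c * f x := rfl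

theorem zero_apply (x : M) : (0 : Lip0 M o) x = 0 := rfl

theorem bddAbove (f : Lip0 M o) :
    BddAbove (Set.range fun p : M × M => |f p.1 - f p.2| / dist p.1 p.2) := by
  obtain ⟨K, hK⟩ := f.2.2
  refine ⟨K, ?_⟩
  rintro _ ⟨⟨x, y⟩, rfl⟩
  exact div_le_of_le_mul₀ dist_nonneg K.2 (by simpa [Real.dist_eq] using hK.dist_le_mul x y)

theorem norm_nonneg' (f : Lip0 M o) : 0 ≤ ‖f‖ :=
  Real.iSup_nonneg fun _ => div_nonneg (abs_nonneg _) dist_nonneg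

theorem abs_sub_le (f : Lip0 M o) (x y : M) : |f x - f y| ≤ ‖f‖ * dist x y := by
  rcases eq_or_ne x y with rfl | h
  · simp
  · rw [← div_le_iff₀ (dist_pos.2 h)]
    exact le_ciSup f.bddAbove (x, y)

theorem norm_le {f : Lip0 M o} {C : ℝ} (hC : 0 ≤ C)
    (h : ∀ x y, |f x - f y| ≤ C * dist x y) : ‖f‖ ≤ C :=
  Real.iSup_le (fun p => div_le_of_le_mul₀ dist_nonneg hC (h p.1 p.2)) hC

theorem normedSpaceCore : NormedSpace.Core ℝ (Lip0 M o) where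
  norm_nonneg := norm_nonneg'
  norm_smul c f := by
    rw [norm_def, norm_def, Real.norm_eq_abs, Real.mul_iSup_of_nonneg (abs_nonneg c)]
    refine iSup_congr fun p => ?_
    rw [smul_apply, smul_apply, ← mul_sub, abs_mul, mul_div_assoc]
  norm_triangle f g := by
    refine norm_le (add_nonneg f.norm_nonneg' g.norm_nonneg') fun x y => ?_
    rw [add_apply, add_apply, add_sub_add_comm, add_mul]
    exact (abs_add_le _ _).trans (add_le_add (f.abs_sub_le x y) (g.abs_sub_le x y))
  norm_eq_zero_iff f := by
    constructor
    · intro h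
      ext x
      have := f.abs_sub_le x o
      rw [h, zero_mul, f.map_base, sub_zero] at this
      rw [zero_apply]
      exact abs_nonpos_iff.1 this
    · rintro rfl
      exact le_antisymm (norm_le le_rfl fun x y => by simp [zero_apply]) (norm_nonneg' _)

noncomputable instance : NormedAddCommGroup (Lip0 M o) := NormedAddCommGroup.ofCore normedSpaceCore

noncomputable instance : NormedSpace ℝ (Lip0 M o) := NormedSpace.ofCore normedSpaceCore

end Lip0

/-- There are `c > 1` and a bijection of `M` onto itself multiplying all distances by `c`. -/
def IsSelfSimilar (M : Type*) [MetricSpace M] : Prop :=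
  ∃ c : ℝ, 1 < c ∧ ∃ f : M ≃ M, ∀ x y, dist (f x) (f y) = c * dist x y

/-- There is `D` such that every closed ball of radius `r > 0` is covered by at most `D` closed
balls of radius `r / 2`. -/
def IsDoubling (M : Type*) [MetricSpace M] : Prop :=
  ∃ D : ℕ, ∀ (x : M) (r : ℝ), 0 < r → ∃ S : Finset M, S.card ≤ D ∧
    Metric.closedBall x r ⊆ ⋃ y ∈ S, Metric.closedBall y (r / 2)

/-- Any point can be moved to any other one by an isometry of `M` onto itself. -/
def IsHomogeneous (M : Type*) [MetricSpace M] : Prop :=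
  ∀ x y : M, ∃ f : M ≃ᵢ M, f x = y

/-- A net: an `ε`-separated and `δ`-dense subset, for some `ε, δ > 0`. -/
def IsNet {M : Type*} [MetricSpace M] (X : Set M) : Prop :=
  (∃ ε : ℝ, 0 < ε ∧ ∀ x ∈ X, ∀ y ∈ X, x ≠ y → ε ≤ dist x y) ∧
    ∃ δ : ℝ, 0 < δ ∧ ∀ x : M, ∃ y ∈ X, dist x y < δ

/-!
Write `A = Lip0 M o`, `B = Lip0 X p` and `P = ℓ^∞(A)`, encoded as `ℕ →ᵇ A`. The theorem follows by
showing that both `A` and `B` are isomorphic to `P`.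

By a variant of the Pełczyński decomposition method (`nonempty_equiv_bcf`), a normed space `Q` is
isomorphic to `P` as soon as `P` is complemented in `Q` and `Q` is complemented in `A`. So two
facts are needed.

* `P` is complemented in `A` and in `B` (`exists_bcf_complemented`). Homogeneity and unboundedness
  provide disjoint balls, indexed by `(i, j)`, and similarities of ratio `c ^ j` which map a ball
  of radius `2 * (j + 1)` about `o` onto the ball with index `(i, j)`. A bounded sequence `F` is
  encoded in a single Lipschitz function by placing on the ball `(i, j)` a cut-off copy of `F i`,
  rescaled so as to keep its Lipschitz constant. Conversely, a Lipschitz function `G` on `M` is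
  blown up along the similarities with indices `(i, j)`, `j → ∞`, and a limit along an ultrafilter
  gives the `i`-th term of a sequence. The blow-up only sees `G` at large scales, so it is enough
  that `G` be defined on a coarsely dense set. No extension theorem is needed for this.

* `B` is complemented in `A` (`exists_extension`). Restriction to `X` has a bounded linear right
  inverse, given by an interpolating Lipschitz partition of unity. Its overlap is bounded because
  `M` is doubling and `X` is separated.

The space with one point, where both spaces of Lipschitz functions vanish, is treated separately.
-/

open scoped BoundedContinuousFunction Topology

/-! ### Pełczyński decomposition for `ℓ^∞`-sums -/

section Decomposition

variable {A Q : Type*} [NormedAddCommGroup A] [NormedSpace ℝ A]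
  [NormedAddCommGroup Q] [NormedSpace ℝ Q]

/-- The left shift on bounded sequences. -/
noncomputable def shiftLeftCLM (A : Type*) [NormedAddCommGroup A] [NormedSpace ℝ A] :
    (ℕ →ᵇ A) →L[ℝ] (ℕ →ᵇ A) :=
  LinearMap.mkContinuous
    { toFun := fun a => a.compContinuous ⟨Nat.succ, continuous_of_discreteTopology⟩
      map_add' := fun _ _ => rfl
      map_smul' := fun _ _ => rfl } 1
    fun a => by
      rw [one_mul]
      exact (BoundedContinuousFunction.norm_le (norm_nonneg a)).2 fun n => a.norm_coe_le_norm _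

@[simp] theorem shiftLeftCLM_apply (a : ℕ →ᵇ A) (n : ℕ) : shiftLeftCLM A a n = a (n + 1) := rfl

/-- The bounded sequence `x, a 0, a 1, …`, as an operator in the pair `(x, a)`. -/
noncomputable def consCLM (A : Type*) [NormedAddCommGroup A] [NormedSpace ℝ A] :
    A × (ℕ →ᵇ A) →L[ℝ] (ℕ →ᵇ A) :=
  have bound : ∀ (z : A × (ℕ →ᵇ A)) (n : ℕ), ‖(Nat.casesOn n z.1 z.2 : A)‖ ≤ ‖z‖ := fun z n => by
    cases n with
    | zero => exact norm_fst_le z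
    | succ n => exact (z.2.norm_coe_le_norm n).trans (norm_snd_le z)
  LinearMap.mkContinuous
    { toFun := fun z =>
        BoundedContinuousFunction.ofNormedAddCommGroupDiscrete
          (fun n => (Nat.casesOn n z.1 z.2 : A)) ‖z‖ (bound z)
      map_add' := fun _ _ => by ext n; cases n <;> rfl
      map_smul' := fun _ _ => by ext n; cases n <;> rfl } 1
    fun z => by
      rw [one_mul]
      exact (BoundedContinuousFunction.norm_le (norm_nonneg z)).2 (bound z)

@[simp] theorem consCLM_apply_zero (z : A × (ℕ →ᵇ A)) : consCLM A z 0 = z.1 := rfl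

@[simp] theorem consCLM_apply_succ (z : A × (ℕ →ᵇ A)) (n : ℕ) :
    consCLM A z (n + 1) = z.2 n := rfl

/-- If `Q` is complemented in `A`, then `ℓ^∞(A)` absorbs one copy of `Q`: writing `A = Q ⊕ W`,
the isomorphism shifts the `Q`-coordinates of a sequence and leaves the `W`-coordinates alone. -/
theorem nonempty_bcf_equiv_prod (i : Q →L[ℝ] A) (r : A →L[ℝ] Q) (h : ∀ x, r (i x) = x) :
    Nonempty ((ℕ →ᵇ A) ≃L[ℝ] Q × (ℕ →ᵇ A)) := by
  let e : A →L[ℝ] A := i ∘L r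
  let e' : (ℕ →ᵇ A) →L[ℝ] (ℕ →ᵇ A) := e.compLeftContinuousBounded ℕ
  have he : ∀ (a : ℕ →ᵇ A) n, e' a n = i (r (a n)) := fun _ _ => rfl
  let u : (ℕ →ᵇ A) →L[ℝ] Q × (ℕ →ᵇ A) :=
    (r ∘L BoundedContinuousFunction.evalCLM ℝ 0).prod
      (e' ∘L shiftLeftCLM A + (ContinuousLinearMap.id ℝ _ - e'))
  let v : Q × (ℕ →ᵇ A) →L[ℝ] (ℕ →ᵇ A) :=
    e' ∘L consCLM A ∘L (i.prodMap (ContinuousLinearMap.id ℝ _)) +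
      (ContinuousLinearMap.id ℝ _ - e') ∘L ContinuousLinearMap.snd ℝ _ _
  refine ⟨ContinuousLinearEquiv.equivOfInverse u v (fun a => ?_) fun z => ?_⟩
  · ext n
    cases n <;> simp [u, v, he, h]
  · refine Prod.ext ?_ ?_
    · simp [u, v, he, h]
    · ext n
      simp [u, v, he, h]

/-- If `ℓ^∞(A)` is complemented in `Q` and `Q` is complemented in `A`, then `Q` is isomorphic to
`ℓ^∞(A)`. -/
theorem nonempty_equiv_bcf (T : (ℕ →ᵇ A) →L[ℝ] Q) (S : Q →L[ℝ] (ℕ →ᵇ A))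
    (hST : ∀ a, S (T a) = a) (i : Q →L[ℝ] A) (r : A →L[ℝ] Q) (h : ∀ x, r (i x) = x) :
    Nonempty (Q ≃L[ℝ] (ℕ →ᵇ A)) := by
  obtain ⟨absorbQ⟩ := nonempty_bcf_equiv_prod i r h
  obtain ⟨absorbP⟩ := nonempty_bcf_equiv_prod (i ∘L T) (S ∘L r) fun a => by simp [h, hST]
  let split : Q ≃L[ℝ] (ℕ →ᵇ A) × S.ker := ContinuousLinearEquiv.equivOfRightInverse S T hST
  -- `Q ≃ P × V ≃ (P × P) × V ≃ P × Q ≃ P`, where `P = ℓ^∞(A)` and `V = ker S`.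
  exact ⟨split.trans <| (absorbP.prodCongr (.refl ℝ _)).trans <|
    (ContinuousLinearEquiv.prodAssoc ℝ _ _ _).trans <|
    ((ContinuousLinearEquiv.refl ℝ _).prodCongr split.symm).trans <|
    (ContinuousLinearEquiv.prodComm ℝ _ _).trans absorbQ.symm⟩

end Decomposition

/-! ### Operators into spaces of Lipschitz functions -/

namespace Lip0

variable {M N E : Type*} [MetricSpace M] [MetricSpace N] [NormedAddCommGroup E] [NormedSpace ℝ E]

/-- A linear family of functions `Φ e` with Lipschitz constants at most `C * ‖e‖` gives a bounded
operator into `Lip0 M o`, after subtracting from each function its value at `o`. -/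
noncomputable def liftCLM (o : M) (Φ : E →ₗ[ℝ] (M → ℝ)) (C : ℝ) (hC : 0 ≤ C)
    (h : ∀ e x y, |Φ e x - Φ e y| ≤ C * ‖e‖ * dist x y) : E →L[ℝ] Lip0 M o :=
  LinearMap.mkContinuous
    { toFun := fun e =>
        (⟨fun x => Φ e x - Φ e o, sub_self _, (C * ‖e‖).toNNReal,
          LipschitzWith.of_dist_le_mul fun x y => by
            rw [Real.dist_eq, sub_sub_sub_cancel_right, Real.coe_toNNReal _ (by positivity)]
            exact h e x y⟩ : lip0Submodule M o)
      map_add' := fun a b => Subtype.ext <| funext fun x => by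
        change Φ (a + b) x - Φ (a + b) o = (Φ a x - Φ a o) + (Φ b x - Φ b o)
        rw [map_add, Pi.add_apply, Pi.add_apply]
        ring
      map_smul' := fun c a => Subtype.ext <| funext fun x => by
        change Φ (c • a) x - Φ (c • a) o = c * (Φ a x - Φ a o)
        rw [map_smul, Pi.smul_apply, Pi.smul_apply, smul_eq_mul, smul_eq_mul]
        ring } C
    fun e => norm_le (by positivity) fun x y => by
      change |(Φ e x - Φ e o) - (Φ e y - Φ e o)| ≤ _
      rw [sub_sub_sub_cancel_right]
      exact h e x y

theorem liftCLM_apply (o : M) (Φ : E →ₗ[ℝ] (M → ℝ)) (C : ℝ) (hC : 0 ≤ C)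
    (h : ∀ e x y, |Φ e x - Φ e y| ≤ C * ‖e‖ * dist x y) (e : E) (x : M) :
    liftCLM o Φ C hC h e x = Φ e x - Φ e o := rfl

/-- Composition with an isometry `ι : N → M`, normalized to vanish at `q`. -/
noncomputable def compIsometryCLM (o : M) (q : N) (ι : N → M) (hι : Isometry ι) :
    Lip0 M o →L[ℝ] Lip0 N q :=
  liftCLM q
    { toFun := fun f x => f (ι x)
      map_add' := fun _ _ => rfl
      map_smul' := fun _ _ => rfl } 1 zero_le_one
    fun f x y => by
      rw [one_mul, ← hι.dist_eq x y]
      exact f.abs_sub_le _ _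

theorem compIsometryCLM_apply (o : M) (q : N) (ι : N → M) (hι : Isometry ι) (f : Lip0 M o)
    (x : N) : compIsometryCLM o q ι hι f x = f (ι x) - f (ι q) := rfl

end Lip0

/-! ### Similarities and disjoint balls -/

section Geometry

variable {M : Type*} [MetricSpace M]

theorem exists_similarity (hhom : IsHomogeneous M) {c : ℝ} {f : M ≃ M}
    (hf : ∀ x y, dist (f x) (f y) = c * dist x y) (k : ℕ) (o x : M) :
    ∃ φ : M ≃ M, φ o = x ∧ ∀ y z, dist (φ y) (φ z) = c ^ k * dist y z := by
  induction k generalizing o with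
  | zero =>
    obtain ⟨g, hg⟩ := hhom o x
    exact ⟨g.toEquiv, hg, fun y z => by simp [g.isometry.dist_eq]⟩
  | succ k ih =>
    obtain ⟨ψ, hψ, hd⟩ := ih (f o)
    refine ⟨f.trans ψ, hψ, fun y z => ?_⟩
    rw [Equiv.trans_apply, Equiv.trans_apply, hd, hf, pow_succ, mul_assoc]

theorem exists_le_dist [Nontrivial M] (hhom : IsHomogeneous M) {c : ℝ} (hc : 1 < c) {f : M ≃ M}
    (hf : ∀ x y, dist (f x) (f y) = c * dist x y) (o : M) (R : ℝ) : ∃ x, R ≤ dist o x := by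
  obtain ⟨a, ha⟩ := exists_ne o
  obtain ⟨k, hk⟩ := pow_unbounded_of_one_lt (R / dist o a) hc
  obtain ⟨φ, hφ, hd⟩ := exists_similarity hhom hf k o o
  refine ⟨φ a, ?_⟩
  have := hd o a
  rw [hφ] at this
  rw [this]
  exact ((div_lt_iff₀ (dist_pos.2 ha.symm)).1 hk).le

/-- In an unbounded space there are pairwise disjoint open balls with prescribed radii. -/
theorem exists_separated_centers (o : M) (hunb : ∀ R : ℝ, ∃ x, R ≤ dist o x) (ρ : ℕ → ℝ)
    (hρ : ∀ n, 0 ≤ ρ n) : ∃ x : ℕ → M, ∀ m n, m < n → ρ m + ρ n ≤ dist (x m) (x n) := by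
  choose g hg using hunb
  -- The balls are chosen one after the other in disjoint annuli about `o`.
  let x : ℕ → M := fun n => Nat.rec o (fun n y => g (dist o y + ρ n + ρ (n + 1))) n
  have hx : ∀ n, dist o (x n) + ρ n + ρ (n + 1) ≤ dist o (x (n + 1)) := fun n => hg _
  have hmono : Monotone fun n => dist o (x n) + ρ n :=
    monotone_nat_of_le_succ fun n => by linarith [hx n, hρ (n + 1)]
  refine ⟨x, fun m n hmn => ?_⟩
  obtain ⟨k, rfl⟩ := Nat.exists_eq_add_of_lt hmn
  have h1 : dist o (x m) + ρ m ≤ dist o (x (m + k)) + ρ (m + k) := hmono (Nat.le_add_right m k)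
  linarith [hx (m + k), dist_triangle o (x m) (x (m + k + 1))]

/-- Similarities `φ (i, j)` with ratio `c ^ j` that map the balls of radius `2 * (j + 1)` about
`o` to pairwise disjoint sets. The disjointness is expressed by a function `ν` which recovers the
index from a point of the image. -/
theorem exists_disjoint_similarities [Nontrivial M] (hhom : IsHomogeneous M) {c : ℝ} (hc : 1 < c)
    {f : M ≃ M} (hf : ∀ x y, dist (f x) (f y) = c * dist x y) (o : M) :
    ∃ (φ : ℕ × ℕ → M ≃ M) (ν : M → ℕ × ℕ),
      (∀ a y z, dist (φ a y) (φ a z) = c ^ a.2 * dist y z) ∧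
      ∀ a y, dist y o < 2 * (a.2 + 1) → ν (φ a y) = a := by
  have hc0 : 0 < c := zero_lt_one.trans hc
  let ρ : ℕ → ℝ := fun n => c ^ n.unpair.2 * (2 * (n.unpair.2 + 1))
  obtain ⟨x, hx⟩ := exists_separated_centers o (exists_le_dist hhom hc hf o) ρ
    fun n => by positivity
  choose φ hφo hφ using fun n : ℕ => exists_similarity hhom hf n.unpair.2 o (x n)
  have huniq : ∀ z m n, dist z (x m) < ρ m → dist z (x n) < ρ n → m = n := by
    intro z m n hm hn
    by_contra hne
    rcases lt_or_gt_of_ne hne with h | h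
    · linarith [hx _ _ h, dist_triangle_left (x m) (x n) z]
    · linarith [hx _ _ h, dist_triangle_left (x n) (x m) z]
  classical
  refine ⟨fun a => φ (Nat.pair a.1 a.2),
    fun z => if h : ∃ n, dist z (x n) < ρ n then h.choose.unpair else 0,
    fun a y z => by simpa using hφ (Nat.pair a.1 a.2) y z, fun a y hy => ?_⟩
  have hmem : dist (φ (Nat.pair a.1 a.2) y) (x (Nat.pair a.1 a.2)) < ρ (Nat.pair a.1 a.2) := by
    rw [← hφo, hφ]
    exact mul_lt_mul_of_pos_left (by simpa using hy) (pow_pos hc0 _)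
  have h : ∃ n, dist (φ (Nat.pair a.1 a.2) y) (x n) < ρ n := ⟨_, hmem⟩
  beta_reduce
  rw [dif_pos h, huniq _ _ _ h.choose_spec hmem, Nat.unpair_pair]

end Geometry

/-! ### Cutting off Lipschitz functions -/

section Cutoff

variable {M : Type*} [MetricSpace M]

/-- The function equal to `1` at distance at most `R` from `o`, equal to `0` at distance at least
`2 * R`, and affine in the distance in between. -/
noncomputable def cutoff (o : M) (R : ℝ) (x : M) : ℝ := max 0 (min 1 (2 - dist x o / R))

theorem cutoff_nonneg (o : M) (R : ℝ) (x : M) : 0 ≤ cutoff o R x := le_max_left _ _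

theorem cutoff_le_one (o : M) (R : ℝ) (x : M) : cutoff o R x ≤ 1 :=
  max_le zero_le_one (min_le_left _ _)

theorem cutoff_eq_one {o : M} {R : ℝ} (hR : 0 < R) {x : M} (h : dist x o ≤ R) :
    cutoff o R x = 1 := by
  have : dist x o / R ≤ 1 := (div_le_one hR).2 h
  rw [cutoff, min_eq_left (by linarith), max_eq_right zero_le_one]

theorem cutoff_eq_zero {o : M} {R : ℝ} (hR : 0 < R) {x : M} (h : 2 * R ≤ dist x o) :
    cutoff o R x = 0 := by
  have : 2 ≤ dist x o / R := (le_div_iff₀ hR).2 h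
  exact max_eq_left ((min_le_right _ _).trans (by linarith))

theorem abs_cutoff_sub_le (o : M) {R : ℝ} (hR : 0 < R) (x y : M) :
    |cutoff o R x - cutoff o R y| ≤ dist x y / R := by
  refine (abs_max_sub_max_le_max _ _ _ _).trans (max_le (by simp; positivity) ?_)
  refine (abs_min_sub_min_le_max _ _ _ _).trans (max_le (by simp; positivity) ?_)
  rw [sub_sub_sub_cancel_left, ← sub_div, abs_div, abs_of_pos hR]
  gcongr
  rw [dist_comm x y]
  exact abs_dist_sub_le _ _ _

/-- The Lipschitz constant does not depend on `R`: the function is of size `‖F‖ * R` where the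
cutoff has slope `1 / R`. -/
theorem abs_cutoff_mul_sub_le {o : M} {R : ℝ} (hR : 0 < R) (F : Lip0 M o) (x y : M) :
    |cutoff o R x * F x - cutoff o R y * F y| ≤ 3 * ‖F‖ * dist x y := by
  have key : ∀ x y, dist x o ≤ 2 * R →
      |cutoff o R x * F x - cutoff o R y * F y| ≤ 3 * ‖F‖ * dist x y := by
    intro x y hx
    have hFx : |F x| ≤ ‖F‖ * (2 * R) := by
      have := F.abs_sub_le x o
      rw [F.map_base, sub_zero] at this
      exact this.trans (mul_le_mul_of_nonneg_left hx F.norm_nonneg')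
    calc |cutoff o R x * F x - cutoff o R y * F y|
        = |(cutoff o R x - cutoff o R y) * F x + cutoff o R y * (F x - F y)| := by
          congr 1; ring
      _ ≤ |cutoff o R x - cutoff o R y| * |F x| + cutoff o R y * |F x - F y| := by
          refine (abs_add_le _ _).trans_eq ?_
          rw [abs_mul, abs_mul, abs_of_nonneg (cutoff_nonneg o R y)]
      _ ≤ dist x y / R * (‖F‖ * (2 * R)) + 1 * (‖F‖ * dist x y) :=
          add_le_add
            (mul_le_mul (abs_cutoff_sub_le o hR x y) hFx (abs_nonneg _) (by positivity))
            (mul_le_mul (cutoff_le_one o R y) (F.abs_sub_le x y) (abs_nonneg _) zero_le_one)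
      _ = 3 * ‖F‖ * dist x y := by field_simp; ring
  rcases le_total (dist x o) (2 * R) with hx | hx
  · exact key x y hx
  rcases le_total (dist y o) (2 * R) with hy | hy
  · rw [abs_sub_comm, dist_comm]
    exact key y x hy
  · rw [cutoff_eq_zero hR hx, cutoff_eq_zero hR hy]
    have := F.norm_nonneg'
    simp only [zero_mul, sub_zero, abs_zero]
    positivity

end Cutoff

/-! ### `ℓ^∞(Lip0 M)` is complemented in `Lip0` of every coarsely dense subset -/

section BlowUp

open Filter

variable {M N : Type*} [MetricSpace M] [MetricSpace N]

/-- Blowing up a Lipschitz function on `N` along maps `θ j : M → N` which, up to a bounded error,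
expand distances by factors tending to infinity. The limit is taken along an ultrafilter so that
it always exists and is linear. -/
theorem exists_blowUp (o : M) (q : N) (θ : ℕ → M → N) (s : ℕ → ℝ) (hs : ∀ j, 0 < s j)
    (hs' : Tendsto (fun j => (s j)⁻¹) atTop (𝓝 0)) (C : ℝ)
    (hθ : ∀ j x y, dist (θ j x) (θ j y) ≤ s j * dist x y + C) :
    ∃ B : Lip0 N q →L[ℝ] Lip0 M o, (∀ G, ‖B G‖ ≤ ‖G‖) ∧
      ∀ G x, Tendsto (fun j => (s j)⁻¹ * (G (θ j x) - G (θ j o))) (hyperfilter ℕ : Filter ℕ)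
        (𝓝 (B G x)) := by
  have hU : (hyperfilter ℕ : Filter ℕ) ≤ atTop := by
    rw [← Nat.cofinite_eq_atTop]
    exact hyperfilter_le_cofinite
  have hbound : ∀ (G : Lip0 N q) x y j,
      |(s j)⁻¹ * (G (θ j x) - G (θ j y))| ≤ ‖G‖ * (dist x y + C * (s j)⁻¹) := by
    intro G x y j
    have hj := hs j
    rw [abs_mul, abs_of_pos (inv_pos.2 hj), inv_mul_le_iff₀ hj]
    calc |G (θ j x) - G (θ j y)| ≤ ‖G‖ * dist (θ j x) (θ j y) := G.abs_sub_le _ _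
      _ ≤ ‖G‖ * (s j * dist x y + C) := mul_le_mul_of_nonneg_left (hθ j x y) G.norm_nonneg'
      _ = s j * (‖G‖ * (dist x y + C * (s j)⁻¹)) := by field_simp
  have hlim : ∀ (G : Lip0 N q) (x y : M),
      Tendsto (fun j => ‖G‖ * (dist x y + C * (s j)⁻¹)) atTop (𝓝 (‖G‖ * dist x y)) := by
    intro G x y
    simpa using ((hs'.const_mul C).const_add (dist x y)).const_mul ‖G‖
  have hex : ∀ (G : Lip0 N q) (x : M), ∃ l : ℝ,
      Tendsto (fun j => (s j)⁻¹ * (G (θ j x) - G (θ j o))) (hyperfilter ℕ : Filter ℕ) (𝓝 l) := by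
    intro G x
    let b := ‖G‖ * dist x o + 1
    have hev : ∀ᶠ j in (hyperfilter ℕ : Filter ℕ),
        (s j)⁻¹ * (G (θ j x) - G (θ j o)) ∈ Set.Icc (-b) b := by
      filter_upwards [hU ((hlim G x o).eventually_le_const (lt_add_one _))] with j hj
      exact abs_le.1 ((hbound G x o j).trans hj)
    obtain ⟨l, -, hl⟩ := (isCompact_Icc (a := -b) (b := b)).ultrafilter_le_nhds
      ((hyperfilter ℕ).map fun j => (s j)⁻¹ * (G (θ j x) - G (θ j o)))
      (le_principal_iff.2 hev)
    exact ⟨l, hl⟩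
  choose ℓ hℓ using hex
  let Φ : Lip0 N q →ₗ[ℝ] (M → ℝ) :=
    { toFun := ℓ
      map_add' := fun G H => funext fun x =>
        tendsto_nhds_unique (hℓ (G + H) x) <| ((hℓ G x).add (hℓ H x)).congr fun j => by
          rw [Lip0.add_apply, Lip0.add_apply]; ring
      map_smul' := fun a G => funext fun x =>
        tendsto_nhds_unique (hℓ (a • G) x) <| ((hℓ G x).const_mul a).congr fun j => by
          rw [Lip0.smul_apply, Lip0.smul_apply]; ring }
  have hΦ : ∀ G x y, |Φ G x - Φ G y| ≤ 1 * ‖G‖ * dist x y := by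
    intro G x y
    rw [one_mul]
    refine le_of_tendsto_of_tendsto ((hℓ G x).sub (hℓ G y)).abs ((hlim G x y).mono_left hU)
      (Eventually.of_forall fun j => ?_)
    refine le_trans (le_of_eq ?_) (hbound G x y j)
    beta_reduce
    rw [← mul_sub, sub_sub_sub_cancel_right]
  have hℓo : ∀ G, Φ G o = 0 := fun G =>
    tendsto_nhds_unique (hℓ G o) (by simp)
  refine ⟨Lip0.liftCLM o Φ 1 zero_le_one hΦ, fun G => ?_, fun G x => ?_⟩
  · refine Lip0.norm_le G.norm_nonneg' fun x y => ?_
    rw [Lip0.liftCLM_apply, Lip0.liftCLM_apply, sub_sub_sub_cancel_right]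
    simpa using hΦ G x y
  · rw [Lip0.liftCLM_apply, hℓo, sub_zero]
    exact hℓ G x

/-- The embedding places infinitely many rescaled and cut-off copies of each term of a bounded
sequence on disjoint balls; blowing up along the copies of each term recovers the sequence. At
large scales the image of `ι` cannot be told from `M`. -/
theorem exists_bcf_complemented [Nontrivial M] (hhom : IsHomogeneous M) (hself : IsSelfSimilar M)
    (o : M) (q : N) (ι : N → M) (hι : Isometry ι) {δ : ℝ} (hδ : ∀ x, ∃ y, dist x (ι y) < δ) :
    ∃ (T : (ℕ →ᵇ Lip0 M o) →L[ℝ] Lip0 N q) (S : Lip0 N q →L[ℝ] (ℕ →ᵇ Lip0 M o)),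
      ∀ F, S (T F) = F := by
  obtain ⟨c, hc, f, hf⟩ := hself
  have hc0 : 0 < c := zero_lt_one.trans hc
  obtain ⟨φ, ν, hφ, hν⟩ := exists_disjoint_similarities hhom hc hf o
  choose π hπ using hδ
  -- The copy of `F i` placed by `φ (i, j)`; it vanishes off the set `ν = (i, j)`.
  let g : (ℕ →ᵇ Lip0 M o) → ℕ × ℕ → M → ℝ := fun F a z =>
    c ^ a.2 * (cutoff o (a.2 + 1) ((φ a).symm z) * F a.1 ((φ a).symm z))
  have hg0 : ∀ F a z, ν z ≠ a → g F a z = 0 := by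
    intro F a z hz
    have : 2 * ((a.2 : ℝ) + 1) ≤ dist ((φ a).symm z) o := by
      by_contra! hlt
      exact hz (by simpa using hν a ((φ a).symm z) hlt)
    simp only [g]
    rw [cutoff_eq_zero (by positivity) this, zero_mul, mul_zero]
  have hgLip : ∀ F a z w, |g F a z - g F a w| ≤ 3 * ‖F‖ * dist z w := by
    intro F a z w
    have hd : dist z w = c ^ a.2 * dist ((φ a).symm z) ((φ a).symm w) := by
      rw [← hφ, Equiv.apply_symm_apply, Equiv.apply_symm_apply]
    simp only [g]
    rw [← mul_sub, abs_mul, abs_of_pos (pow_pos hc0 _), hd, mul_left_comm]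
    refine mul_le_mul_of_nonneg_left ?_ (pow_pos hc0 _).le
    refine (abs_cutoff_mul_sub_le (by positivity) _ _ _).trans ?_
    gcongr
    exact F.norm_coe_le_norm a.1
  let Φ : (ℕ →ᵇ Lip0 M o) →ₗ[ℝ] (N → ℝ) :=
    { toFun := fun F x => g F (ν (ι x)) (ι x)
      map_add' := fun F G => funext fun x => by
        simp only [g, Pi.add_apply, BoundedContinuousFunction.add_apply, Lip0.add_apply]
        ring
      map_smul' := fun r F => funext fun x => by
        simp only [g, Pi.smul_apply, BoundedContinuousFunction.smul_apply, Lip0.smul_apply,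
          smul_eq_mul, RingHom.id_apply]
        ring }
  have hΦ : ∀ F x y, |Φ F x - Φ F y| ≤ 6 * ‖F‖ * dist x y := by
    intro F x y
    change |g F (ν (ι x)) (ι x) - g F (ν (ι y)) (ι y)| ≤ _
    rw [← hι.dist_eq x y]
    by_cases h : ν (ι x) = ν (ι y)
    · rw [h]
      refine (hgLip F _ _ _).trans ?_
      gcongr
      norm_num
    · -- Each of the two pieces vanishes at the point belonging to the other.
      have h1 := hgLip F (ν (ι x)) (ι x) (ι y)
      have h2 := hgLip F (ν (ι y)) (ι x) (ι y)
      rw [hg0 F _ (ι y) (Ne.symm h), sub_zero] at h1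
      rw [hg0 F _ (ι x) h, zero_sub, abs_neg] at h2
      refine (abs_sub _ _).trans ?_
      linarith
  let T : (ℕ →ᵇ Lip0 M o) →L[ℝ] Lip0 N q := Lip0.liftCLM q Φ 6 (by norm_num) hΦ
  have hinv : Tendsto (fun j : ℕ => (c ^ j)⁻¹) atTop (𝓝 0) :=
    (tendsto_pow_atTop_atTop_of_one_lt hc).inv_tendsto_atTop
  choose B hBnorm hB using fun i : ℕ =>
    exists_blowUp o q (fun j x => π (φ (i, j) x)) (fun j => c ^ j) (fun j => pow_pos hc0 j) hinv
      (2 * δ) fun j x y => by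
        rw [← hι.dist_eq, ← hφ (i, j) x y]
        have h1 := hπ (φ (i, j) x)
        have h2 := hπ (φ (i, j) y)
        have h3 := dist_triangle4 (ι (π (φ (i, j) x))) (φ (i, j) x) (φ (i, j) y)
          (ι (π (φ (i, j) y)))
        rw [dist_comm] at h1
        linarith
  have hSbound : ∀ (G : Lip0 N q) i, ‖B i G‖ ≤ ‖G‖ := fun G i => hBnorm i G
  let S : Lip0 N q →L[ℝ] (ℕ →ᵇ Lip0 M o) :=
    LinearMap.mkContinuous
      { toFun := fun G =>
          BoundedContinuousFunction.ofNormedAddCommGroupDiscrete (fun i => B i G) ‖G‖ (hSbound G)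
        map_add' := fun G H => by ext i : 1; exact map_add (B i) G H
        map_smul' := fun r G => by ext i : 1; exact map_smul (B i) r G } 1
      fun G => by
        rw [one_mul]
        exact (BoundedContinuousFunction.norm_le (norm_nonneg G)).2 (hSbound G)
  refine ⟨T, S, fun F => ?_⟩
  ext i : 1
  change B i (T F) = F i
  ext x
  have hU : (hyperfilter ℕ : Filter ℕ) ≤ atTop := by
    rw [← Nat.cofinite_eq_atTop]
    exact hyperfilter_le_cofinite
  -- The `j`-th copy is read off at the points `w y j`, which converge to `y`.
  let w : M → ℕ → M := fun y j => (φ (i, j)).symm (ι (π (φ (i, j) y)))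
  have hwdist : ∀ y j, dist (w y j) y ≤ (c ^ j)⁻¹ * δ := by
    intro y j
    rw [le_inv_mul_iff₀ (pow_pos hc0 j), ← hφ (i, j), Equiv.apply_symm_apply, dist_comm]
    exact (hπ _).le
  have hwlim : ∀ y, Tendsto (fun j => dist (w y j) y) atTop (𝓝 0) := fun y =>
    squeeze_zero (fun _ => dist_nonneg) (hwdist y) (by simpa using hinv.mul_const δ)
  have hFlim : ∀ y, Tendsto (fun j => F i (w y j)) atTop (𝓝 (F i y)) := by
    intro y
    rw [tendsto_iff_dist_tendsto_zero]
    refine squeeze_zero (fun _ => dist_nonneg) (fun j => ?_)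
      (by simpa using (hwlim y).const_mul ‖F i‖)
    rw [Real.dist_eq]
    exact (F i).abs_sub_le _ _
  have hread : ∀ y, ∀ᶠ j : ℕ in atTop,
      (c ^ j)⁻¹ * Φ F (π (φ (i, j) y)) = F i (w y j) := by
    intro y
    filter_upwards [(hwlim y).eventually_le_const zero_lt_one,
      tendsto_natCast_atTop_atTop.eventually_ge_atTop (dist y o)] with j h1 h2
    have hw : dist (w y j) o ≤ j + 1 := by linarith [dist_triangle (w y j) y o]
    have hνw : ν (ι (π (φ (i, j) y))) = (i, j) := by
      have := hν (i, j) (w y j) (by simp only; linarith [(Nat.cast_nonneg j : (0 : ℝ) ≤ j)])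
      rwa [Equiv.apply_symm_apply] at this
    change (c ^ j)⁻¹ * g F (ν (ι (π (φ (i, j) y)))) (ι (π (φ (i, j) y))) = _
    rw [hνw]
    change (c ^ j)⁻¹ * (c ^ j * (cutoff o (j + 1) (w y j) * F i (w y j))) = _
    rw [cutoff_eq_one (by positivity) hw, one_mul, inv_mul_cancel_left₀ (pow_pos hc0 j).ne']
  have hlim := (hFlim x).sub (hFlim o)
  rw [(F i).map_base, sub_zero] at hlim
  refine tendsto_nhds_unique (hB i (T F) x) (Tendsto.mono_left ?_ hU)
  refine hlim.congr' ?_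
  filter_upwards [hread x, hread o] with j hx ho
  change _ = (c ^ j)⁻¹ * ((Φ F (π (φ (i, j) x)) - Φ F q) - (Φ F (π (φ (i, j) o)) - Φ F q))
  rw [sub_sub_sub_cancel_right, mul_sub, hx, ho]

end BlowUp

/-! ### Extension from a net -/

section Extension

variable {M : Type*} [MetricSpace M]

theorem IsDoubling.exists_cover (h : IsDoubling M) (k : ℕ) :
    ∃ N : ℕ, ∀ (x : M) (r : ℝ), 0 < r → ∃ S : Finset M, S.card ≤ N ∧
      Metric.closedBall x r ⊆ ⋃ y ∈ S, Metric.closedBall y (r / 2 ^ k) := by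
  classical
  obtain ⟨D, hD⟩ := h
  induction k with
  | zero => exact ⟨1, fun x r _ => ⟨{x}, by simp, by simp⟩⟩
  | succ k ih =>
    obtain ⟨N, hN⟩ := ih
    refine ⟨N * D, fun x r hr => ?_⟩
    obtain ⟨S, hS, hcov⟩ := hN x r hr
    choose U hU hUcov using fun y => hD y (r / 2 ^ k) (by positivity)
    refine ⟨S.biUnion U, Finset.card_biUnion_le_card_mul _ _ _ (fun y _ => hU y) |>.trans ?_, ?_⟩
    · exact Nat.mul_le_mul_right D hS
    · intro z hz
      obtain ⟨y, hy, hzy⟩ := Set.mem_iUnion₂.1 (hcov hz)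
      obtain ⟨u, hu, hzu⟩ := Set.mem_iUnion₂.1 (hUcov y hzy)
      refine Set.mem_iUnion₂.2 ⟨u, Finset.mem_biUnion.2 ⟨y, hy, hu⟩, ?_⟩
      rwa [pow_succ, ← div_div]

/-- In a doubling space, a separated set has boundedly many points in balls of a given radius. -/
theorem IsDoubling.exists_card_le (h : IsDoubling M) {X : Set M} {ε : ℝ} (hε : 0 < ε)
    (hsep : ∀ x ∈ X, ∀ y ∈ X, x ≠ y → ε ≤ dist x y) {r : ℝ} (hr : 0 < r) :
    ∃ N : ℕ, ∀ (x : M) (F : Finset X), (∀ y ∈ F, dist x y ≤ r) → F.card ≤ N := by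
  obtain ⟨k, hk⟩ := pow_unbounded_of_one_lt (2 * r / ε) one_lt_two
  obtain ⟨N, hN⟩ := h.exists_cover k
  refine ⟨N, fun x F hF => ?_⟩
  obtain ⟨S, hS, hcov⟩ := hN x r hr
  have hmem : ∀ y : X, y ∈ F → ∃ s ∈ S, dist (y : M) s ≤ r / 2 ^ k := by
    intro y hy
    have : (y : M) ∈ Metric.closedBall x r := by
      rw [Metric.mem_closedBall, dist_comm]
      exact hF y hy
    obtain ⟨s, hs, hys⟩ := Set.mem_iUnion₂.1 (hcov this)
    exact ⟨s, hs, hys⟩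
  have : Nonempty M := ⟨x⟩
  choose! s hs hd using hmem
  refine (Finset.card_le_card_of_injOn s hs fun a ha b hb hab => ?_).trans hS
  by_contra hne
  have h1 := hd a ha
  have h2 := hd b hb
  rw [← hab] at h2
  have h3 := hsep a a.2 b b.2 (Subtype.coe_injective.ne hne)
  have h4 : 2 * (r / 2 ^ k) < ε := by
    rw [← mul_div_assoc, div_lt_iff₀ (by positivity)]
    exact (div_lt_iff₀' hε).1 hk
  linarith [dist_triangle_right (a : M) b (s a)]

theorem IsDoubling.finite_setOf_dist_le (h : IsDoubling M) {X : Set M} {ε : ℝ} (hε : 0 < ε)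
    (hsep : ∀ x ∈ X, ∀ y ∈ X, x ≠ y → ε ≤ dist x y) {r : ℝ} (hr : 0 < r) (x : M) :
    {y : X | dist x y ≤ r}.Finite := by
  obtain ⟨N, hN⟩ := h.exists_card_le hε hsep hr
  by_contra hinf
  obtain ⟨F, hF, hcard⟩ := Set.Infinite.exists_subset_card_eq hinf (N + 1)
  have := hN x F fun y hy => hF hy
  omega

/-- A Lipschitz partition of unity subordinate to a net which is interpolating, in the sense that
the function belonging to a point of the net equals `1` there. The finsets `K x` contain the
indices of all functions that do not vanish at `x`. -/
theorem exists_partitionOfUnity (hdoub : IsDoubling M) {X : Set M} (hX : IsNet X) :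
    ∃ (K : M → Finset X) (φ : X → M → ℝ) (N : ℕ) (C r : ℝ), 0 ≤ C ∧ 0 ≤ r ∧
      (∀ y x, 0 ≤ φ y x) ∧ (∀ x, (K x).card ≤ N) ∧ (∀ x, ∀ y ∈ K x, dist x y ≤ r) ∧
      (∀ x y, y ∉ K x → φ y x = 0) ∧ (∀ x, ∑ y ∈ K x, φ y x = 1) ∧
      (∀ y x x', |φ y x - φ y x'| ≤ C * dist x x') ∧ ∀ y : X, φ y y = 1 := by
  classical
  obtain ⟨⟨ε, hε, hsep⟩, δ, hδ, hdense⟩ := hX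
  have hr : 0 < 2 * δ + ε / 2 := by positivity
  obtain ⟨N, hN⟩ := hdoub.exists_card_le hε hsep hr
  let K : M → Finset X := fun x => (hdoub.finite_setOf_dist_le hε hsep hr x).toFinset
  have hK : ∀ x y, y ∈ K x ↔ dist x (y : M) ≤ 2 * δ + ε / 2 := by simp [K]
  have hcard : ∀ x, (K x).card ≤ N := fun x => hN x _ fun y hy => (hK x y).1 hy
  have hρδ : ∀ x, Metric.infDist x X < δ := fun x => by
    obtain ⟨y, hy, hxy⟩ := hdense x
    exact (Metric.infDist_le_dist_of_mem hy).trans_lt hxy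
  -- At a point of the net `infDist` vanishes, so only the weight of that point survives there.
  let w : X → M → ℝ := fun y x => max 0 (2 * Metric.infDist x X + ε / 2 - dist x y)
  have hw0 : ∀ y x, 0 ≤ w y x := fun y x => le_max_left _ _
  have hwK : ∀ x y, y ∉ K x → w y x = 0 := by
    intro x y hy
    rw [hK, not_le] at hy
    exact max_eq_left (by linarith [hρδ x])
  have hwLip : ∀ y x x', |w y x - w y x'| ≤ 3 * dist x x' := by
    intro y x x'
    refine (abs_max_sub_max_le_max _ _ _ _).trans (max_le (by simp) ?_)
    have h1 : |Metric.infDist x X - Metric.infDist x' X| ≤ dist x x' := by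
      simpa [Real.dist_eq] using (Metric.lipschitz_infDist_pt X).dist_le_mul x x'
    have h2 : |dist x (y : M) - dist x' y| ≤ dist x x' := abs_dist_sub_le _ _ _
    rw [abs_le] at *
    constructor <;> linarith [h1.1, h1.2, h2.1, h2.2]
  let s : M → ℝ := fun x => ∑ y ∈ K x, w y x
  have hs : ∀ x, ε / 4 ≤ s x := by
    intro x
    have hne : X.Nonempty := let ⟨y, hy, _⟩ := hdense x; ⟨y, hy⟩
    obtain ⟨y, hy, hxy⟩ := (Metric.infDist_lt_iff hne).1
      (lt_add_of_pos_right (Metric.infDist x X) (by positivity : 0 < ε / 4))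
    have hwy : ε / 4 ≤ w ⟨y, hy⟩ x :=
      le_max_of_le_right (by simp only; linarith [Metric.infDist_nonneg (x := x) (s := X)])
    have hmem : (⟨y, hy⟩ : X) ∈ K x := by
      by_contra h
      rw [hwK x _ h] at hwy
      linarith
    exact hwy.trans (Finset.single_le_sum (f := fun y => w y x) (fun y _ => hw0 y x) hmem)
  have hspos : ∀ x, 0 < s x := fun x => (by positivity : 0 < ε / 4).trans_le (hs x)
  have hsLip : ∀ x x', |s x - s x'| ≤ 2 * N * (3 * dist x x') := by
    intro x x'
    have h1 : s x = ∑ y ∈ K x ∪ K x', w y x :=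
      Finset.sum_subset Finset.subset_union_left fun y _ hy => hwK x y hy
    have h2 : s x' = ∑ y ∈ K x ∪ K x', w y x' :=
      Finset.sum_subset Finset.subset_union_right fun y _ hy => hwK x' y hy
    rw [h1, h2, ← Finset.sum_sub_distrib]
    refine (Finset.abs_sum_le_sum_abs _ _).trans
      ((Finset.sum_le_card_nsmul _ _ _ fun y _ => hwLip y x x').trans ?_)
    rw [nsmul_eq_mul]
    gcongr
    have := (Finset.card_union_le (K x) (K x')).trans (add_le_add (hcard x) (hcard x'))
    rw [← two_mul] at this
    exact_mod_cast this
  have hws : ∀ y x, w y x ≤ s x := by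
    intro y x
    by_cases hy : y ∈ K x
    · exact Finset.single_le_sum (f := fun y => w y x) (fun y _ => hw0 y x) hy
    · rw [hwK x y hy]
      exact (hspos x).le
  refine ⟨K, fun y x => w y x / s x, N, 4 / ε * (3 + 2 * N * 3), 2 * δ + ε / 2, by positivity,
    hr.le, fun y x => div_nonneg (hw0 y x) (hspos x).le, hcard, fun x y hy => (hK x y).1 hy,
    fun x y hy => by simp only [hwK x y hy, zero_div], fun x => ?_, fun y x x' => ?_, fun y => ?_⟩
  · rw [← Finset.sum_div]
    exact div_self (hspos x).ne'
  · have hx := (hspos x).ne'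
    have hx' := (hspos x').ne'
    have heq : w y x / s x - w y x' / s x' =
        (s x)⁻¹ * ((w y x - w y x') + w y x' / s x' * (s x' - s x)) := by
      field_simp
      ring
    have hinv : (s x)⁻¹ ≤ 4 / ε := by
      rw [← inv_div ε 4]
      exact inv_anti₀ (by positivity) (hs x)
    have hq : |w y x' / s x'| ≤ 1 := by
      rw [abs_of_nonneg (div_nonneg (hw0 y x') (hspos x').le)]
      exact (div_le_one (hspos x')).2 (hws y x')
    have hmid : |(w y x - w y x') + w y x' / s x' * (s x' - s x)| ≤
        3 * dist x x' + 1 * (2 * N * (3 * dist x x')) := by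
      refine (abs_add_le _ _).trans (add_le_add (hwLip y x x') ?_)
      rw [abs_mul, abs_sub_comm]
      exact mul_le_mul hq (hsLip x x') (abs_nonneg _) zero_le_one
    rw [heq, abs_mul, abs_of_pos (inv_pos.2 (hspos x))]
    calc (s x)⁻¹ * |(w y x - w y x') + w y x' / s x' * (s x' - s x)|
        ≤ 4 / ε * (3 * dist x x' + 1 * (2 * N * (3 * dist x x'))) :=
          mul_le_mul hinv hmid (abs_nonneg _) (by positivity)
      _ = 4 / ε * (3 + 2 * N * 3) * dist x x' := by ring
  · have hsy : s y = w y y := by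
      refine Finset.sum_eq_single y (fun z _ hz => ?_) fun h => hwK y y h
      refine max_eq_left ?_
      have := hsep y y.2 z z.2 (Subtype.coe_injective.ne hz.symm)
      rw [Metric.infDist_zero_of_mem y.2]
      linarith
    simp only [← hsy]
    exact div_self (hspos y).ne'

/-- Averaging the values on a net with an interpolating partition of unity is a bounded linear
extension operator. -/
theorem exists_extension (hdoub : IsDoubling M) {X : Set M} (hX : IsNet X) (o : M) (p : X) :
    ∃ (i : Lip0 X p →L[ℝ] Lip0 M o) (r : Lip0 M o →L[ℝ] Lip0 X p), ∀ f, r (i f) = f := by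
  classical
  obtain ⟨K, φ, N, C, r, hC, hr, hφ0, hcard, hK, hφK, hsum, hLip, hone⟩ :=
    exists_partitionOfUnity hdoub hX
  let Φ : Lip0 X p →ₗ[ℝ] (M → ℝ) :=
    { toFun := fun f x => ∑ y ∈ K x, φ y x * f y
      map_add' := fun f g => funext fun x => by
        simp only [Lip0.add_apply, mul_add, Finset.sum_add_distrib, Pi.add_apply]
      map_smul' := fun a f => funext fun x => by
        simp only [Lip0.smul_apply, mul_left_comm _ a, ← Finset.mul_sum, Pi.smul_apply,
          smul_eq_mul, RingHom.id_apply] }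
  have hΦ_sub : ∀ f x a, Φ f x - a = ∑ y ∈ K x, φ y x * (f y - a) := by
    intro f x a
    simp only [mul_sub, Finset.sum_sub_distrib, ← Finset.sum_mul, hsum, one_mul]
    rfl
  have hne : ∀ x, (K x).Nonempty := by
    intro x
    by_contra h
    have := hsum x
    rw [Finset.not_nonempty_iff_eq_empty.1 h, Finset.sum_empty] at this
    exact zero_ne_one this
  choose n hn using hne
  have hfdist : ∀ (f : Lip0 X p) (y z : X), |f y - f z| ≤ ‖f‖ * dist (y : M) z :=
    fun f y z => f.abs_sub_le y z
  have hnear : ∀ f x, |Φ f x - f (n x)| ≤ ‖f‖ * (2 * r) := by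
    intro f x
    rw [hΦ_sub]
    refine (Finset.abs_sum_le_sum_abs _ _).trans ?_
    calc ∑ y ∈ K x, |φ y x * (f y - f (n x))| ≤ ∑ y ∈ K x, φ y x * (‖f‖ * (2 * r)) := by
          refine Finset.sum_le_sum fun y hy => ?_
          rw [abs_mul, abs_of_nonneg (hφ0 y x)]
          refine mul_le_mul_of_nonneg_left ((hfdist f y (n x)).trans ?_) (hφ0 y x)
          refine mul_le_mul_of_nonneg_left ?_ f.norm_nonneg'
          linarith [hK x y hy, hK x _ (hn x), dist_triangle_left (y : M) (n x) x]
      _ = ‖f‖ * (2 * r) := by rw [← Finset.sum_mul, hsum, one_mul]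
  let C' : ℝ := max (2 * N * (C * (2 * r + 1))) (6 * r + 1)
  have hΦ : ∀ f x x', |Φ f x - Φ f x'| ≤ C' * ‖f‖ * dist x x' := by
    intro f x x'
    have hf := f.norm_nonneg'
    have hd : 0 ≤ dist x x' := dist_nonneg
    rcases le_total (dist x x') 1 with hxx | hxx
    · have h1 : Φ f x - f (n x) = ∑ y ∈ K x ∪ K x', φ y x * (f y - f (n x)) := by
        rw [hΦ_sub]
        exact Finset.sum_subset Finset.subset_union_left fun y _ hy => by
          rw [hφK x y hy, zero_mul]
      have h2 : Φ f x' - f (n x) = ∑ y ∈ K x ∪ K x', φ y x' * (f y - f (n x)) := by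
        rw [hΦ_sub]
        exact Finset.sum_subset Finset.subset_union_right fun y _ hy => by
          rw [hφK x' y hy, zero_mul]
      rw [← sub_sub_sub_cancel_right _ _ (f (n x)), h1, h2, ← Finset.sum_sub_distrib]
      have hterm : ∀ y ∈ K x ∪ K x', |φ y x * (f y - f (n x)) - φ y x' * (f y - f (n x))| ≤
          C * dist x x' * (‖f‖ * (2 * r + 1)) := by
        intro y hy
        rw [← sub_mul, abs_mul]
        refine mul_le_mul (hLip y x x') ((hfdist f y (n x)).trans ?_) (abs_nonneg _)
          (by positivity)
        refine mul_le_mul_of_nonneg_left ?_ hf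
        have h3 := hK x _ (hn x)
        have h4 := dist_triangle_left (y : M) (n x) x
        rcases Finset.mem_union.1 hy with hy | hy
        · linarith [hK x y hy]
        · linarith [hK x' y hy, dist_triangle x x' y]
      have hcard' : ((K x ∪ K x').card : ℝ) ≤ 2 * N := by
        have := (Finset.card_union_le (K x) (K x')).trans (add_le_add (hcard x) (hcard x'))
        rw [← two_mul] at this
        exact_mod_cast this
      calc |∑ y ∈ K x ∪ K x', (φ y x * (f y - f (n x)) - φ y x' * (f y - f (n x)))|
          ≤ ((K x ∪ K x').card : ℝ) * (C * dist x x' * (‖f‖ * (2 * r + 1))) := by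
            rw [← nsmul_eq_mul]
            exact (Finset.abs_sum_le_sum_abs _ _).trans (Finset.sum_le_card_nsmul _ _ _ hterm)
        _ ≤ 2 * N * (C * dist x x' * (‖f‖ * (2 * r + 1))) :=
            mul_le_mul_of_nonneg_right hcard' (by positivity)
        _ = 2 * N * (C * (2 * r + 1)) * ‖f‖ * dist x x' := by ring
        _ ≤ C' * ‖f‖ * dist x x' := by gcongr; exact le_max_left _ _
    · have h1 := hnear f x
      have h2 := hnear f x'
      have h3 : |f (n x) - f (n x')| ≤ ‖f‖ * (2 * r + dist x x') := by
        refine (hfdist f _ _).trans (mul_le_mul_of_nonneg_left ?_ hf)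
        have := dist_triangle4 (n x : M) x x' (n x')
        rw [dist_comm _ x] at this
        linarith [hK x _ (hn x), hK x' _ (hn x')]
      have h4 : |Φ f x - Φ f x'| ≤ ‖f‖ * (6 * r + dist x x') := by
        rw [abs_le] at *
        constructor <;> linarith [h1.1, h1.2, h2.1, h2.2, h3.1, h3.2]
      refine h4.trans ?_
      calc ‖f‖ * (6 * r + dist x x') ≤ ‖f‖ * (6 * r * dist x x' + dist x x') := by
            refine mul_le_mul_of_nonneg_left (add_le_add_left ?_ _) hf
            exact le_mul_of_one_le_right (by positivity) hxx
        _ = (6 * r + 1) * ‖f‖ * dist x x' := by ring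
        _ ≤ C' * ‖f‖ * dist x x' := by gcongr; exact le_max_right _ _
  have hΦX : ∀ (f : Lip0 X p) (y : X), Φ f y = f y := by
    intro f y
    have hy : y ∈ K y := by
      by_contra h
      exact one_ne_zero ((hone y).symm.trans (hφK y y h))
    -- The other terms vanish since the weights are nonnegative and already sum to `1`.
    have hrest : ∑ z ∈ (K y).erase y, φ z y = 0 := by
      have := Finset.add_sum_erase (K y) (fun z => φ z y) hy
      rw [hsum, hone] at this
      linarith
    rw [Finset.sum_eq_zero_iff_of_nonneg fun z _ => hφ0 z y] at hrest
    change ∑ z ∈ K y, φ z y * f z = f y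
    rw [Finset.sum_eq_single_of_mem y hy fun z hz hzy => by
      rw [hrest z (Finset.mem_erase.2 ⟨hzy, hz⟩), zero_mul], hone, one_mul]
  refine ⟨Lip0.liftCLM o Φ C' (le_max_of_le_right (by positivity)) hΦ,
    Lip0.compIsometryCLM o p Subtype.val isometry_subtype_coe, fun f => ?_⟩
  ext x
  rw [Lip0.compIsometryCLM_apply, Lip0.liftCLM_apply, Lip0.liftCLM_apply, hΦX, hΦX, f.map_base]
  ring

end Extension

/-! ### The isomorphism -/

theorem Lip0.subsingleton {M : Type*} [MetricSpace M] [Subsingleton M] (o : M) :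
    Subsingleton (Lip0 M o) :=
  ⟨fun f g => Lip0.ext fun x => by rw [Subsingleton.elim x o, f.map_base, g.map_base]⟩

theorem mainTheorem12 {M : Type*} [MetricSpace M] (o : M)
    (hself : IsSelfSimilar M) (hdoub : IsDoubling M) (hhom : IsHomogeneous M)
    (X : Set M) (hX : IsNet X) (p : X) :
    Nonempty (Lip0 M o ≃L[ℝ] Lip0 X p) := by
  rcases subsingleton_or_nontrivial M with hM | hM
  · have := Lip0.subsingleton o
    have := Lip0.subsingleton p
    exact ⟨.equivOfInverse 0 0 (fun _ => Subsingleton.elim _ _) fun _ => Subsingleton.elim _ _⟩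
  obtain ⟨δ, -, hδ⟩ := hX.2
  obtain ⟨T, S, hST⟩ := exists_bcf_complemented hhom hself o o id isometry_id (δ := 1)
    fun x => ⟨x, by simp⟩
  obtain ⟨T', S', hST'⟩ := exists_bcf_complemented hhom hself o p Subtype.val
    isometry_subtype_coe fun x => let ⟨y, hy, h⟩ := hδ x; ⟨⟨y, hy⟩, h⟩
  obtain ⟨i, r, hri⟩ := exists_extension hdoub hX o p
  obtain ⟨u⟩ := nonempty_equiv_bcf T S hST (.id ℝ _) (.id ℝ _) fun _ => rfl
  obtain ⟨v⟩ := nonempty_equiv_bcf T' S' hST' i r hri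
  exact ⟨u.trans v.symm⟩
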